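/- Let $G$ be a finite simple connected graph with $n \ge 2$ vertices, $m$ edges and maximum degree $\Delta$. For $\alpha\in[0,1]$ let $A_\alpha(G)=\alpha D(G)+(1-\alpha)A(G)$, where $A(G)$ is the adjacency matrix and $D(G)$ the diagonal matrix of vertex degrees of $G$; let $\rho_1\ge\rho_2\ge\dots\ge\rho_n$ be the eigenvalues of $A_\alpha(G)$, counted with multiplicity, and let $$E_{A_\alpha}(G)=\sum_{i=1}^n\left|\rho_i-\frac{2\alpha m}{n}\right|$$ be the $A_\alpha$-energy of $G$. If $\frac12<\alpha<1$, then $$E_{A_\alpha}(G)\le\alpha\left(4m-3\Delta-\frac{4m}{n}+1\right)+\sqrt{\alpha^2(\Delta+1)^2+4(1-2\alpha)\Delta}.$$ Moreover, for each such $\alpha$, equality holds if and only if $G$ is isomorphic to the star $K_{1,n-1}$. -/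

import Mathlib

namespace SimpleGraph

variable {V : Type*} [Fintype V] [DecidableEq V]

/-- The matrix `A_α(G) = α D(G) + (1 - α) A(G)`. -/
noncomputable def alphaMatrix (G : SimpleGraph V) [DecidableRel G.Adj] (α : ℝ) : Matrix V V ℝ :=
  α • G.degMatrix ℝ + (1 - α) • G.adjMatrix ℝ

theorem isHermitian_alphaMatrix (G : SimpleGraph V) [DecidableRel G.Adj] (α : ℝ) :
    (G.alphaMatrix α).IsHermitian := by
  have hD : (G.degMatrix ℝ).IsHermitian := by
    rw [Matrix.IsHermitian, Matrix.conjTranspose_eq_transpose_of_trivial]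
    exact Matrix.diagonal_transpose _
  have hA : (G.adjMatrix ℝ).IsHermitian := by
    rw [Matrix.IsHermitian, Matrix.conjTranspose_eq_transpose_of_trivial]
    exact G.isSymm_adjMatrix
  rw [Matrix.IsHermitian, alphaMatrix, Matrix.conjTranspose_add, Matrix.conjTranspose_smul,
    Matrix.conjTranspose_smul, hD.eq, hA.eq, star_trivial, star_trivial]

/-- The `A_α`-energy `∑ |ρ_i - 2αm/n|`, the sum being over the `n` eigenvalues `ρ_i` of `A_α(G)`
counted with multiplicity, where `n` is the order and `m` the size of `G`. -/
noncomputable def alphaEnergy (G : SimpleGraph V) [DecidableRel G.Adj] (α : ℝ) : ℝ :=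
  ∑ i : V, |(G.isHermitian_alphaMatrix α).eigenvalues i
    - 2 * α * (G.edgeFinset.card : ℝ) / (Fintype.card V : ℝ)|

end SimpleGraph

/-!
Let `u` have maximal degree `d` and write `A_α(G) = A_α(S) + A_α(R)`, where `S` consists of the
edges of `G` at `u` and `R` of the remaining ones. As a quadratic form, `A_α(S)` is at most `α • 1`
plus a positive semidefinite matrix of rank one and trace `ρ - α`, where `ρ` is the spectral radius
of `A_α(K_{1,d})`; and `A_α(R)` is positive semidefinite for `α ≥ 1/2`, of trace `2α(m - d)`. Hence
any `k` eigenvalues of `A_α(G)` sum to at most `kα + (ρ - α) + 2α(m - d)`.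

The trace of `A_α(G)` is `nt` with `t = 2αm/n`, so the energy is twice the sum of `ρ_i - t` over the
`k ≥ 1` eigenvalues `ρ_i ≥ t`. As `α ≤ t`, it is at most `2(ρ + 2α(m - d) - t)`, which is the bound.
If `R` has an edge, this is strict: for `k ≥ 2` because then `α < t`, and for `k = 1` because the
form of `A_α(R)` at a unit vector is smaller than its trace. If `R` has no edge, `G` is a star, and
its eigenvalue `ρ` alone contributes `2(ρ - t)` to the energy.
-/

open SimpleGraph Matrix Finset

namespace AlphaMatrix

section OrthonormalBasis

variable {ι κ : Type*} [Fintype ι] [Fintype κ]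
  (e : OrthonormalBasis κ ℝ (EuclideanSpace ℝ ι)) {A B : Matrix ι ι ℝ}

theorem dotProduct_basis_self (k : κ) : e k ⬝ᵥ e k = 1 := by
  have h := e.inner_eq_one k
  rwa [EuclideanSpace.inner_eq_star_dotProduct, star_trivial] at h

theorem sum_dotProduct_mulVec_eq_trace (B : Matrix ι ι ℝ) :
    ∑ k, e k ⬝ᵥ B *ᵥ e k = B.trace := by
  classical
  rw [← trace_toLin_eq B (PiLp.basisFun 2 ℝ ι), ← toLpLin_eq_toLin,
    LinearMap.trace_eq_sum_inner _ e]
  simp only [EuclideanSpace.inner_eq_star_dotProduct, star_trivial, ofLp_toLpLin, toLin'_apply,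
    dotProduct_comm (e _)]

theorem sum_dotProduct_mulVec_le_trace (hB : B.PosSemidef) (K : Finset κ) :
    ∑ k ∈ K, e k ⬝ᵥ B *ᵥ e k ≤ B.trace := by
  rw [← sum_dotProduct_mulVec_eq_trace e B]
  exact sum_le_univ_sum_of_nonneg fun k => hB.dotProduct_mulVec_nonneg (e k)

theorem sum_dotProduct_mulVec_le {c : ℝ} (hB : B.PosSemidef)
    (hAB : ∀ x : ι → ℝ, x ⬝ᵥ A *ᵥ x ≤ c * (x ⬝ᵥ x) + x ⬝ᵥ B *ᵥ x) (K : Finset κ) :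
    ∑ k ∈ K, e k ⬝ᵥ A *ᵥ e k ≤ c * #K + B.trace :=
  calc ∑ k ∈ K, e k ⬝ᵥ A *ᵥ e k
      ≤ ∑ k ∈ K, (c * (e k ⬝ᵥ e k) + e k ⬝ᵥ B *ᵥ e k) := sum_le_sum fun k _ => hAB (e k)
    _ = c * #K + ∑ k ∈ K, e k ⬝ᵥ B *ᵥ e k := by
        simp only [dotProduct_basis_self, mul_one, sum_add_distrib, sum_const, nsmul_eq_mul,
          mul_comm]
    _ ≤ c * #K + B.trace := by
        gcongr
        exact sum_dotProduct_mulVec_le_trace e hB K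

theorem eigenvalues_eq_dotProduct [DecidableEq ι] (hA : A.IsHermitian) (i : ι) :
    hA.eigenvalues i = hA.eigenvectorBasis i ⬝ᵥ A *ᵥ hA.eigenvectorBasis i := by
  rw [hA.mulVec_eigenvectorBasis, dotProduct_smul, dotProduct_basis_self, smul_eq_mul, mul_one]

end OrthonormalBasis

theorem sum_abs_eq_two_mul_sum_filter_nonneg {ι R : Type*} [CommRing R] [LinearOrder R]
    [IsStrictOrderedRing R] {s : Finset ι} {f : ι → R} (h : ∑ i ∈ s, f i = 0) :
    ∑ i ∈ s, |f i| = 2 * ∑ i ∈ s with 0 ≤ f i, f i := by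
  have h_abs_add (i : ι) : |f i| + f i = if 0 ≤ f i then 2 * f i else 0 := by
    split_ifs with hi
    · rw [abs_of_nonneg hi, two_mul]
    · rw [abs_of_neg (not_le.1 hi), neg_add_cancel]
  rw [mul_sum, sum_filter, ← sum_congr rfl fun i _ => h_abs_add i, sum_add_distrib, h, add_zero]

theorem two_mul_le_sum_abs {ι R : Type*} [CommRing R] [LinearOrder R] [IsStrictOrderedRing R]
    {s : Finset ι} {f : ι → R} (h : ∑ i ∈ s, f i = 0) {i : ι} (hi : i ∈ s) :
    2 * f i ≤ ∑ j ∈ s, |f j| := by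
  rcases le_total 0 (f i) with hf | hf
  · rw [sum_abs_eq_two_mul_sum_filter_nonneg h]
    gcongr
    exact single_le_sum (fun j hj => (mem_filter.1 hj).2) (mem_filter.2 ⟨hi, hf⟩)
  · exact (mul_nonpos_of_nonneg_of_nonpos zero_le_two hf).trans
      (sum_nonneg fun j _ => abs_nonneg (f j))

theorem le_two_mul_mul_div_iff {a : ℝ} {m n : ℕ} (ha : 0 < a) (hn : 0 < n) :
    a ≤ 2 * a * m / n ↔ n ≤ 2 * m := by
  rw [le_div_iff₀ (Nat.cast_pos.2 hn), mul_comm 2 a, mul_assoc, mul_le_mul_iff_right₀ ha]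
  norm_cast

theorem lt_two_mul_mul_div_iff {a : ℝ} {m n : ℕ} (ha : 0 < a) (hn : 0 < n) :
    a < 2 * a * m / n ↔ n < 2 * m := by
  rw [lt_div_iff₀ (Nat.cast_pos.2 hn), mul_comm 2 a, mul_assoc, mul_lt_mul_iff_right₀ ha]
  norm_cast

section StarRadius

/-- The larger root of `ρ² - α(d + 1)ρ + (2α - 1)d`, which for integers `d ≥ 1` and `α ≥ 0` is the
spectral radius of `A_α(K_{1,d})`. -/
noncomputable def starRadius (α d : ℝ) : ℝ :=
  (α * (d + 1) + √(α ^ 2 * (d + 1) ^ 2 + 4 * (1 - 2 * α) * d)) / 2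

variable (α : ℝ) {d : ℝ}

theorem two_mul_starRadius_sub_nonneg (d : ℝ) : 0 ≤ 2 * starRadius α d - α * (d + 1) := by
  simp only [starRadius]
  linarith [Real.sqrt_nonneg (α ^ 2 * (d + 1) ^ 2 + 4 * (1 - 2 * α) * d)]

theorem starRadius_sq (hd : 0 ≤ d) :
    starRadius α d ^ 2 = α * (d + 1) * starRadius α d - (2 * α - 1) * d := by
  have h_disc : 0 ≤ α ^ 2 * (d + 1) ^ 2 + 4 * (1 - 2 * α) * d := by
    calc 0 ≤ α ^ 2 * (d - 1) ^ 2 + 4 * ((1 - α) ^ 2 * d) := by positivity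
      _ = _ := by ring
  simp only [starRadius]
  linear_combination Real.sq_sqrt h_disc / 4

theorem eq_zero_of_two_mul_starRadius_sub_eq_zero {α : ℝ} (hd : 0 ≤ d)
    (h : 2 * starRadius α d - α * (d + 1) = 0) : α * (d - 1) = 0 ∧ (1 - α) ^ 2 * d = 0 := by
  have h_sum : (α * (d - 1)) ^ 2 + 4 * ((1 - α) ^ 2 * d) = 0 := by
    linear_combination (2 * starRadius α d - α * (d + 1)) * h - 4 * starRadius_sq α hd
  have h_nonneg : 0 ≤ (1 - α) ^ 2 * d := by positivity
  exact ⟨by nlinarith, by nlinarith⟩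

theorem starForm_le {α : ℝ} (hα : 0 < α) (hd : 0 ≤ d) (x s : ℝ) :
    α * (d - 1) * x ^ 2 + 2 * (1 - α) * x * s ≤
      ((starRadius α d - α) * x + (1 - α) * s) ^ 2 / (2 * starRadius α d - α * (d + 1)) := by
  -- The denominator vanishes only for `α = d = 1`, where both sides are `0`.
  rcases (two_mul_starRadius_sub_nonneg α d).eq_or_lt' with h | h
  · obtain ⟨hd1, hα1⟩ := eq_zero_of_two_mul_starRadius_sub_eq_zero hd h
    obtain rfl : d = 1 := by simpa only [mul_eq_zero, hα.ne', false_or, sub_eq_zero] using hd1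
    have hα1 : 1 - α = 0 := by simpa only [mul_one, pow_eq_zero_iff two_ne_zero] using hα1
    simp [h, hα1]
  · rw [le_div_iff₀ h, ← sub_nonneg]
    refine (sq_nonneg ((α * d - starRadius α d) * x + (1 - α) * s)).trans_eq ?_
    ring

theorem starRadius_sub_eq_div (hd : 0 ≤ d) :
    starRadius α d - α =
      ((starRadius α d - α) ^ 2 + (1 - α) ^ 2 * d) / (2 * starRadius α d - α * (d + 1)) := by
  rcases eq_or_ne (2 * starRadius α d - α * (d + 1)) 0 with h | h
  · rw [h, div_zero]
    linarith [eq_zero_of_two_mul_starRadius_sub_eq_zero hd h]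
  · rw [eq_div_iff h]
    linear_combination starRadius_sq α hd

end StarRadius

section StarGraph

variable {V : Type*}

theorem sdiff_deleteIncidenceSet_le_starGraph (G : SimpleGraph V) (u : V) :
    G \ G.deleteIncidenceSet u ≤ starGraph u := fun v w h => by
  rw [sdiff_adj, deleteIncidenceSet_adj] at h
  exact starGraph_adj.2 ⟨h.1.ne, by tauto⟩

variable [Fintype V]

theorem card_le_card_edgeFinset_add_one {G : SimpleGraph V} [DecidableRel G.Adj]
    (hG : G.Connected) : Fintype.card V ≤ #G.edgeFinset + 1 := by
  simpa only [Nat.card_eq_fintype_card, edgeFinset_card] using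
    hG.card_vert_le_card_edgeSet_add_one

theorem eq_starGraph_iff_card_edgeFinset_eq_degree {G : SimpleGraph V} [DecidableRel G.Adj]
    (hG : G.Connected) (u : V) : G = starGraph u ↔ #G.edgeFinset = G.degree u := by
  classical
  refine ⟨fun h => ?_, fun h => ?_⟩
  · have h_tree : G.IsTree := h ▸ isTree_starGraph u
    have h_degree : G.degree u = Fintype.card V - 1 := by
      subst h
      convert degree_starGraph_center (r := u)
    have := h_tree.card_edgeFinset
    omega
  · have h_bot : G.deleteIncidenceSet u = ⊥ := by
      rw [← edgeFinset_eq_empty, ← card_eq_zero, card_edgeFinset_deleteIncidenceSet, h,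
        Nat.sub_self]
    have h_le : G ≤ starGraph u := by
      simpa only [h_bot, sdiff_bot] using sdiff_deleteIncidenceSet_le_starGraph G u
    exact (isTree_iff_minimal_connected.1 (isTree_starGraph u)).eq_of_le hG h_le

theorem exists_eq_starGraph_iff {G : SimpleGraph V} [DecidableRel G.Adj] (hG : G.Connected) {u : V}
    (hu : G.maxDegree = G.degree u) : (∃ w, G = starGraph w) ↔ G = starGraph u := by
  refine ⟨fun ⟨w, hw⟩ => ?_, fun h => ⟨u, h⟩⟩
  rw [eq_starGraph_iff_card_edgeFinset_eq_degree hG] at hw ⊢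
  have h_le := G.degree_le_maxDegree w
  exact (hw.trans_le (h_le.trans hu.le)).antisymm (G.degree_le_card_edgeFinset u)

theorem nonempty_iso_completeBipartiteGraph_one_iff (G : SimpleGraph V) :
    Nonempty (G ≃g completeBipartiteGraph (Fin 1) (Fin (Fintype.card V - 1))) ↔
      ∃ u, G = starGraph u := by
  classical
  constructor
  · rintro ⟨f⟩
    refine ⟨f.symm (Sum.inl 0), SimpleGraph.ext <| funext₂ fun v w => propext ?_⟩
    rw [starGraph_adj, ← f.map_adj_iff, ← f.injective.ne_iff, RelIso.eq_symm_apply,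
      RelIso.eq_symm_apply, completeBipartiteGraph_adj]
    rcases f v with x | x <;> rcases f w with y | y <;> simp [Subsingleton.elim _ (0 : Fin 1)]
  · rintro ⟨u, rfl⟩
    have h_card : Fintype.card {v // v ≠ u} = Fintype.card V - 1 := by
      rw [Fintype.card_subtype_compl, Fintype.card_subtype_eq]
    let e : V ≃ Fin 1 ⊕ Fin (Fintype.card V - 1) := (Equiv.sumCompl (· = u)).symm.trans
      (Equiv.sumCongr (Equiv.ofUnique _ _) (Fintype.equivFinOfCardEq h_card))
    have h_isLeft (v : V) : (e v).isLeft ↔ v = u := by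
      obtain rfl | hv := eq_or_ne v u
      · simp [e]
      · simp [e, hv, Equiv.sumCompl_symm_apply_of_neg]
    refine ⟨⟨e, fun {v w} => ?_⟩⟩
    rw [starGraph_adj, completeBipartiteGraph_adj]
    simp only [← Sum.not_isLeft, h_isLeft]
    grind

end StarGraph

section QuadraticForm

variable {V : Type*} [Fintype V] [DecidableEq V] (G : SimpleGraph V) [DecidableRel G.Adj] {α : ℝ}

theorem alphaMatrix_mulVec_apply (α : ℝ) (x : V → ℝ) (v : V) :
    (G.alphaMatrix α *ᵥ x) v = ∑ w ∈ G.neighborFinset v, (α * x v + (1 - α) * x w) := by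
  rw [alphaMatrix, add_mulVec, smul_mulVec, smul_mulVec, Pi.add_apply, Pi.smul_apply, Pi.smul_apply,
    degMatrix_mulVec_apply, adjMatrix_mulVec_apply, sum_add_distrib, sum_const,
    card_neighborFinset_eq_degree, ← mul_sum, nsmul_eq_mul, smul_eq_mul, smul_eq_mul,
    mul_left_comm]

theorem trace_alphaMatrix (α : ℝ) : (G.alphaMatrix α).trace = 2 * α * #G.edgeFinset := by
  have h_deg : ∑ v, (G.degree v : ℝ) = 2 * #G.edgeFinset := by
    exact_mod_cast G.sum_degrees_eq_twice_card_edges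
  rw [alphaMatrix, trace_add, trace_smul, trace_smul, trace_adjMatrix, degMatrix, trace_diagonal,
    h_deg, smul_zero, add_zero, smul_eq_mul, mul_left_comm, mul_assoc]

theorem posSemidef_degMatrix_add_adjMatrix : (G.degMatrix ℝ + G.adjMatrix ℝ).PosSemidef := by
  have h : G.degMatrix ℝ + G.adjMatrix ℝ = G.incMatrix ℝ * (G.incMatrix ℝ)ᴴ := by
    rw [conjTranspose_eq_transpose_of_trivial, incMatrix_mul_transpose]
    ext v w
    obtain rfl | hvw := eq_or_ne v w <;> simp [degMatrix, *]
  exact h ▸ posSemidef_self_mul_conjTranspose _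

theorem alphaMatrix_eq_add_lapMatrix (α : ℝ) :
    G.alphaMatrix α =
      (1 / 2 : ℝ) • (G.degMatrix ℝ + G.adjMatrix ℝ) + (α - 1 / 2) • G.lapMatrix ℝ := by
  rw [alphaMatrix, lapMatrix]
  module

theorem posSemidef_alphaMatrix (hα : 1 / 2 ≤ α) : (G.alphaMatrix α).PosSemidef := by
  rw [alphaMatrix_eq_add_lapMatrix]
  exact ((posSemidef_degMatrix_add_adjMatrix G).smul (by norm_num)).add
    ((posSemidef_lapMatrix ℝ G).smul (sub_nonneg.2 hα))

theorem dotProduct_degMatrix_mulVec_le (x : V → ℝ) :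
    x ⬝ᵥ G.degMatrix ℝ *ᵥ x ≤ #G.edgeFinset * (x ⬝ᵥ x) := by
  rw [dotProduct_mulVec_degMatrix, dotProduct, mul_sum]
  refine sum_le_sum fun v _ => ?_
  rw [mul_assoc]
  gcongr
  · exact mul_self_nonneg _
  · exact G.degree_le_card_edgeFinset v

theorem dotProduct_alphaMatrix_mulVec_lt (hα : 1 / 2 < α) (hG : 0 < #G.edgeFinset) {x : V → ℝ}
    (hx : x ⬝ᵥ x = 1) : x ⬝ᵥ G.alphaMatrix α *ᵥ x < 2 * α * #G.edgeFinset := by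
  have h_signless : 0 ≤ x ⬝ᵥ G.degMatrix ℝ *ᵥ x + x ⬝ᵥ G.adjMatrix ℝ *ᵥ x := by
    simpa only [star_trivial, add_mulVec, dotProduct_add]
      using (posSemidef_degMatrix_add_adjMatrix G).dotProduct_mulVec_nonneg x
  have h_lap : 0 ≤ x ⬝ᵥ G.degMatrix ℝ *ᵥ x - x ⬝ᵥ G.adjMatrix ℝ *ᵥ x := by
    simpa only [star_trivial, lapMatrix, sub_mulVec, dotProduct_sub]
      using (posSemidef_lapMatrix ℝ G).dotProduct_mulVec_nonneg x
  have h_deg : x ⬝ᵥ G.degMatrix ℝ *ᵥ x ≤ #G.edgeFinset := by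
    simpa only [hx, mul_one] using dotProduct_degMatrix_mulVec_le G x
  have hm : (0 : ℝ) < #G.edgeFinset := Nat.cast_pos.2 hG
  simp only [alphaMatrix, add_mulVec, smul_mulVec, dotProduct_add, dotProduct_smul, smul_eq_mul]
  rcases le_total α 1 with hα1 | hα1 <;> nlinarith

variable {G} {H : SimpleGraph V} [DecidableRel H.Adj]

theorem alphaMatrix_sdiff_add (h : H ≤ G) (α : ℝ) :
    (G \ H).alphaMatrix α + H.alphaMatrix α = G.alphaMatrix α := by
  have h_subset (v : V) : H.neighborFinset v ⊆ G.neighborFinset v := fun w => by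
    simpa only [mem_neighborFinset] using @h v w
  refine ext_of_mulVec_single fun i => funext fun v => ?_
  rw [add_mulVec, Pi.add_apply, alphaMatrix_mulVec_apply, alphaMatrix_mulVec_apply,
    alphaMatrix_mulVec_apply, neighborFinset_sdiff, sum_sdiff (h_subset v)]

end QuadraticForm

section Star

theorem neighborFinset_of_le_starGraph {V : Type*} [Fintype V] {S : SimpleGraph V}
    [DecidableRel S.Adj] {u v : V} (hS : S ≤ starGraph u) (hv : v ≠ u) :
    S.neighborFinset v = if S.Adj u v then {u} else ∅ := by
  ext w
  have h_center (h : S.Adj v w) : w = u := (starGraph_adj.1 (hS h)).2.resolve_left hv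
  grind [mem_neighborFinset, adj_comm]

variable {V : Type*} [Fintype V] [DecidableEq V]

/-- The eigenvector of the star formed by the edges of `G` at `u`: with `ρ = starRadius α (deg u)`
it takes the value `ρ - α` at `u`, `1 - α` at the neighbours of `u` and `0` elsewhere. It is
zero, hence no eigenvector, when `α = deg u = 1`. -/
noncomputable def starVector (G : SimpleGraph V) [DecidableRel G.Adj] (α : ℝ) (u : V) : V → ℝ :=
  Pi.single u (starRadius α (G.degree u) - α) + (1 - α) • G.adjMatrix ℝ u

section StarVector

variable (G : SimpleGraph V) [DecidableRel G.Adj] (α : ℝ) (u : V)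

theorem starVector_dotProduct (x : V → ℝ) :
    starVector G α u ⬝ᵥ x =
      (starRadius α (G.degree u) - α) * x u + (1 - α) * ∑ v ∈ G.neighborFinset u, x v := by
  rw [starVector, add_dotProduct, single_dotProduct, smul_dotProduct, smul_eq_mul,
    ← adjMatrix_mulVec_apply]
  rfl

theorem starVector_self : starVector G α u u = starRadius α (G.degree u) - α := by
  simp [starVector]

theorem starVector_of_ne {v : V} (h : v ≠ u) :
    starVector G α u v = if G.Adj u v then 1 - α else 0 := by
  simp [starVector, h]

theorem sum_starVector_neighborFinset :
    ∑ v ∈ G.neighborFinset u, starVector G α u v = G.degree u * (1 - α) := by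
  rw [← card_neighborFinset_eq_degree, ← nsmul_eq_mul, ← sum_const]
  refine sum_congr rfl fun v hv => ?_
  rw [mem_neighborFinset] at hv
  rw [starVector_of_ne G α u hv.ne', if_pos hv]

theorem starVector_dotProduct_self :
    starVector G α u ⬝ᵥ starVector G α u =
      (starRadius α (G.degree u) - α) ^ 2 + (1 - α) ^ 2 * G.degree u := by
  rw [starVector_dotProduct, starVector_self, sum_starVector_neighborFinset]
  ring

end StarVector

variable {S : SimpleGraph V} [DecidableRel S.Adj] {u : V} {α : ℝ}

theorem alphaMatrix_mulVec_starVector (hS : S ≤ starGraph u) :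
    S.alphaMatrix α *ᵥ starVector S α u = starRadius α (S.degree u) • starVector S α u := by
  ext v
  rw [alphaMatrix_mulVec_apply, Pi.smul_apply, smul_eq_mul]
  obtain rfl | hv := eq_or_ne v u
  · rw [sum_add_distrib, sum_const, ← mul_sum, sum_starVector_neighborFinset, starVector_self,
      card_neighborFinset_eq_degree, nsmul_eq_mul]
    linear_combination -starRadius_sq α (Nat.cast_nonneg (S.degree v))
  · rw [neighborFinset_of_le_starGraph hS hv, starVector_of_ne S α u hv]
    split_ifs
    · rw [sum_singleton, starVector_self]
      ring
    · rw [sum_empty, mul_zero]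

theorem dotProduct_alphaMatrix_mulVec_of_le_starGraph (hS : S ≤ starGraph u) (x : V → ℝ) :
    x ⬝ᵥ S.alphaMatrix α *ᵥ x = α * (S.degree u * x u ^ 2 + ∑ v ∈ S.neighborFinset u, x v ^ 2) +
      2 * (1 - α) * x u * ∑ v ∈ S.neighborFinset u, x v := by
  have h_leaf (v : V) (hv : v ∈ univ.erase u) : x v * (S.alphaMatrix α *ᵥ x) v =
      if S.Adj u v then α * x v ^ 2 + (1 - α) * x u * x v else 0 := by
    rw [alphaMatrix_mulVec_apply, neighborFinset_of_le_starGraph hS (ne_of_mem_erase hv)]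
    split_ifs
    · rw [sum_singleton]
      ring
    · rw [sum_empty, mul_zero]
  have h_filter : {v ∈ univ.erase u | S.Adj u v} = S.neighborFinset u := by
    ext v
    simpa using fun h : S.Adj u v => h.ne'
  rw [dotProduct, ← add_sum_erase _ _ (mem_univ u), sum_congr rfl h_leaf, ← sum_filter, h_filter,
    alphaMatrix_mulVec_apply, sum_add_distrib, sum_add_distrib, sum_const,
    card_neighborFinset_eq_degree, nsmul_eq_mul, ← mul_sum, ← mul_sum, ← mul_sum]
  ring

theorem dotProduct_alphaMatrix_mulVec_le_of_le_starGraph (hS : S ≤ starGraph u) (hα : 0 < α)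
    (x : V → ℝ) :
    x ⬝ᵥ S.alphaMatrix α *ᵥ x ≤ α * (x ⬝ᵥ x) + (starVector S α u ⬝ᵥ x) ^ 2 /
      (2 * starRadius α (S.degree u) - α * (S.degree u + 1)) := by
  have h_norm : x u ^ 2 + ∑ v ∈ S.neighborFinset u, x v ^ 2 ≤ x ⬝ᵥ x := by
    rw [← sum_insert (f := fun v => x v ^ 2) (S.notMem_neighborFinset_self u), dotProduct]
    simp only [← sq]
    exact sum_le_univ_sum_of_nonneg fun v => sq_nonneg (x v)
  have h_star := starForm_le hα (S.degree u).cast_nonneg (x u) (∑ v ∈ S.neighborFinset u, x v)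
  rw [dotProduct_alphaMatrix_mulVec_of_le_starGraph hS, starVector_dotProduct]
  linarith [mul_le_mul_of_nonneg_left h_norm hα.le]

theorem sum_dotProduct_alphaMatrix_mulVec_le_of_le_starGraph (hS : S ≤ starGraph u) (hα : 0 < α)
    {κ : Type*} [Fintype κ] (e : OrthonormalBasis κ ℝ (EuclideanSpace ℝ V)) (K : Finset κ) :
    ∑ k ∈ K, e k ⬝ᵥ S.alphaMatrix α *ᵥ e k ≤ α * #K + (starRadius α (S.degree u) - α) := by
  set c := 2 * starRadius α (S.degree u) - α * (S.degree u + 1)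
  set B := c⁻¹ • vecMulVec (starVector S α u) (starVector S α u) with hB
  have h_posSemidef : B.PosSemidef := by
    have h := posSemidef_vecMulVec_self_star (starVector S α u)
    rw [star_trivial] at h
    exact h.smul (inv_nonneg.2 (two_mul_starRadius_sub_nonneg α _))
  have h_trace : B.trace = starRadius α (S.degree u) - α := by
    rw [hB, trace_smul, trace_vecMulVec, starVector_dotProduct_self, smul_eq_mul,
      inv_mul_eq_div, ← starRadius_sub_eq_div α (S.degree u).cast_nonneg]
  rw [← h_trace]
  refine sum_dotProduct_mulVec_le e h_posSemidef (fun x => ?_) K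
  convert dotProduct_alphaMatrix_mulVec_le_of_le_starGraph hS hα x using 2
  rw [hB, smul_mulVec, vecMulVec_mulVec, dotProduct_smul, dotProduct_smul, dotProduct_comm x,
    smul_eq_mul, op_smul_eq_smul, smul_eq_mul, ← sq, inv_mul_eq_div]

end Star

section Spectrum

variable {V : Type*} [Fintype V] [DecidableEq V] (G : SimpleGraph V) [DecidableRel G.Adj]

theorem degree_sdiff_deleteIncidenceSet (u : V) :
    (G \ G.deleteIncidenceSet u).degree u = G.degree u := by
  simp only [← card_neighborFinset_eq_degree]
  congr 1
  ext v
  simp [deleteIncidenceSet_adj]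

theorem trace_alphaMatrix_deleteIncidenceSet (α : ℝ) (u : V) :
    ((G.deleteIncidenceSet u).alphaMatrix α).trace = 2 * α * (#G.edgeFinset - G.degree u) := by
  rw [trace_alphaMatrix, card_edgeFinset_deleteIncidenceSet,
    Nat.cast_sub (G.degree_le_card_edgeFinset u)]

variable {α : ℝ}

theorem eigenvalues_eq_sdiff_add_deleteIncidenceSet (u i : V) :
    (G.isHermitian_alphaMatrix α).eigenvalues i =
      (G.isHermitian_alphaMatrix α).eigenvectorBasis i ⬝ᵥ
        (G \ G.deleteIncidenceSet u).alphaMatrix α *ᵥ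
          (G.isHermitian_alphaMatrix α).eigenvectorBasis i +
      (G.isHermitian_alphaMatrix α).eigenvectorBasis i ⬝ᵥ
        (G.deleteIncidenceSet u).alphaMatrix α *ᵥ
          (G.isHermitian_alphaMatrix α).eigenvectorBasis i := by
  rw [← dotProduct_add, ← add_mulVec, alphaMatrix_sdiff_add (G.deleteIncidenceSet_le u),
    eigenvalues_eq_dotProduct]

theorem sum_eigenvalues_le (hα : 1 / 2 ≤ α) (u : V) (K : Finset V) :
    ∑ i ∈ K, (G.isHermitian_alphaMatrix α).eigenvalues i ≤
      α * #K + (starRadius α (G.degree u) - α) + 2 * α * (#G.edgeFinset - G.degree u) := by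
  simp only [eigenvalues_eq_sdiff_add_deleteIncidenceSet G u, sum_add_distrib]
  rw [← trace_alphaMatrix_deleteIncidenceSet, ← degree_sdiff_deleteIncidenceSet]
  gcongr
  · exact sum_dotProduct_alphaMatrix_mulVec_le_of_le_starGraph
      (sdiff_deleteIncidenceSet_le_starGraph G u) (by linarith) _ K
  · exact sum_dotProduct_mulVec_le_trace _ (posSemidef_alphaMatrix _ hα) K

theorem eigenvalues_lt (hα : 1 / 2 < α) {u : V} (hu : G.degree u < #G.edgeFinset) (i : V) :
    (G.isHermitian_alphaMatrix α).eigenvalues i <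
      starRadius α (G.degree u) + 2 * α * (#G.edgeFinset - G.degree u) := by
  have h_star := sum_dotProduct_alphaMatrix_mulVec_le_of_le_starGraph
    (sdiff_deleteIncidenceSet_le_starGraph G u) (by linarith)
    (G.isHermitian_alphaMatrix α).eigenvectorBasis {i}
  have h_rest := dotProduct_alphaMatrix_mulVec_lt (G.deleteIncidenceSet u) hα
    (by rw [card_edgeFinset_deleteIncidenceSet]; omega)
    (dotProduct_basis_self (G.isHermitian_alphaMatrix α).eigenvectorBasis i)
  rw [← trace_alphaMatrix, trace_alphaMatrix_deleteIncidenceSet] at h_rest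
  rw [sum_singleton, card_singleton, degree_sdiff_deleteIncidenceSet, Nat.cast_one] at h_star
  rw [eigenvalues_eq_sdiff_add_deleteIncidenceSet G u]
  linarith

end Spectrum

section Energy

variable {V : Type*} [Fintype V] [DecidableEq V] (G : SimpleGraph V) [DecidableRel G.Adj] (α : ℝ)

theorem sum_eigenvalues_sub_mean [Nonempty V] :
    ∑ i, ((G.isHermitian_alphaMatrix α).eigenvalues i -
      2 * α * #G.edgeFinset / Fintype.card V) = 0 := by
  have h_trace := (G.isHermitian_alphaMatrix α).trace_eq_sum_eigenvalues
  simp only [RCLike.ofReal_real_eq_id, id_eq] at h_trace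
  rw [sum_sub_distrib, ← h_trace, trace_alphaMatrix, sum_const, card_univ, nsmul_eq_mul,
    mul_div_cancel₀ _ (Nat.cast_ne_zero.2 Fintype.card_ne_zero), sub_self]

theorem exists_alphaEnergy_eq_two_mul_sum_sub [Nonempty V] :
    ∃ I : Finset V, I.Nonempty ∧ G.alphaEnergy α =
      2 * (∑ i ∈ I, (G.isHermitian_alphaMatrix α).eigenvalues i -
        #I * (2 * α * #G.edgeFinset / Fintype.card V)) := by
  have h_mean := sum_eigenvalues_sub_mean G α
  refine ⟨({i | 0 ≤ (G.isHermitian_alphaMatrix α).eigenvalues i -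
    2 * α * #G.edgeFinset / Fintype.card V} : Finset V), ?_, ?_⟩
  · obtain ⟨i, -, hi⟩ := exists_le_of_sum_le univ_nonempty (sum_const_zero.trans h_mean.symm).le
    exact ⟨i, mem_filter.2 ⟨mem_univ i, hi⟩⟩
  · rw [alphaEnergy, sum_abs_eq_two_mul_sum_filter_nonneg h_mean, sum_sub_distrib, sum_const,
      nsmul_eq_mul]

theorem two_mul_sub_le_alphaEnergy [Nonempty V] {μ : ℝ} (hμ : μ ∈ spectrum ℝ (G.alphaMatrix α)) :
    2 * (μ - 2 * α * #G.edgeFinset / Fintype.card V) ≤ G.alphaEnergy α := by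
  rw [(G.isHermitian_alphaMatrix α).spectrum_real_eq_range_eigenvalues] at hμ
  obtain ⟨i, rfl⟩ := hμ
  exact two_mul_le_sum_abs (sum_eigenvalues_sub_mean G α) (mem_univ i)

variable {G} {α}

theorem alphaEnergy_le (hG : G.Connected) (hV : 1 < Fintype.card V) (hα : 1 / 2 ≤ α) (u : V) :
    G.alphaEnergy α ≤ 2 * (starRadius α (G.degree u) + 2 * α * (#G.edgeFinset - G.degree u) -
      2 * α * #G.edgeFinset / Fintype.card V) := by
  have := hG.nonempty
  obtain ⟨I, hI, hE⟩ := exists_alphaEnergy_eq_two_mul_sum_sub G α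
  have h_mean : α ≤ 2 * α * #G.edgeFinset / Fintype.card V := by
    refine (le_two_mul_mul_div_iff (by linarith) (by omega)).2 ?_
    have := card_le_card_edgeFinset_add_one hG
    omega
  have one_le_card : (1 : ℝ) ≤ #I := by exact_mod_cast hI.card_pos
  linarith [sum_eigenvalues_le G hα u I,
    mul_nonneg (sub_nonneg.2 one_le_card) (sub_nonneg.2 h_mean)]

theorem alphaEnergy_lt (hG : G.Connected) (hV : 1 < Fintype.card V) (hα : 1 / 2 < α) {u : V}
    (hu : G.degree u < #G.edgeFinset) :
    G.alphaEnergy α < 2 * (starRadius α (G.degree u) + 2 * α * (#G.edgeFinset - G.degree u) -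
      2 * α * #G.edgeFinset / Fintype.card V) := by
  have := hG.nonempty
  obtain ⟨I, hI, hE⟩ := exists_alphaEnergy_eq_two_mul_sum_sub G α
  obtain h_one | h_two : #I = 1 ∨ 2 ≤ #I := by
    have := hI.card_pos
    omega
  · obtain ⟨i, rfl⟩ := card_eq_one.1 h_one
    rw [sum_singleton, card_singleton, Nat.cast_one, one_mul] at hE
    linarith [eigenvalues_lt G hα hu i]
  · have h_mean : α < 2 * α * #G.edgeFinset / Fintype.card V := by
      refine (lt_two_mul_mul_div_iff (by linarith) Fintype.card_pos).2 ?_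
      have := card_le_card_edgeFinset_add_one hG
      have : Nontrivial V := Fintype.one_lt_card_iff_nontrivial.1 hV
      have := hG.preconnected.degree_pos_of_nontrivial u
      omega
    have one_lt_card : (1 : ℝ) < #I := by exact_mod_cast h_two
    linarith [sum_eigenvalues_le G hα.le u I,
      mul_pos (sub_pos.2 one_lt_card) (sub_pos.2 h_mean)]

theorem starRadius_mem_spectrum {S : SimpleGraph V} [DecidableRel S.Adj] {u : V}
    (hS : S ≤ starGraph u) (h : starVector S α u ≠ 0) :
    starRadius α (S.degree u) ∈ spectrum ℝ (S.alphaMatrix α) := by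
  rw [← Matrix.spectrum_toLin']
  exact (Module.End.hasEigenvalue_of_hasEigenvector (x := starVector S α u)
    ⟨Module.End.mem_eigenspace_iff.2 (alphaMatrix_mulVec_starVector hS), h⟩).mem_spectrum

theorem two_mul_starRadius_sub_le_alphaEnergy {S : SimpleGraph V} [DecidableRel S.Adj] {u : V}
    (hS : S ≤ starGraph u) (hα : 0 < α) (hV : Fintype.card V ≤ 2 * #S.edgeFinset) :
    2 * (starRadius α (S.degree u) - 2 * α * #S.edgeFinset / Fintype.card V) ≤
      S.alphaEnergy α := by
  have : Nonempty V := ⟨u⟩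
  by_cases h : starVector S α u = 0
  · have h_mean := (le_two_mul_mul_div_iff hα Fintype.card_pos).2 hV
    have h_nonneg : 0 ≤ S.alphaEnergy α := sum_nonneg fun i _ => abs_nonneg _
    have h_radius : starRadius α (S.degree u) = α := by
      rw [← sub_eq_zero, ← starVector_self, h, Pi.zero_apply]
    linarith
  · exact two_mul_sub_le_alphaEnergy S α (starRadius_mem_spectrum hS h)

theorem alphaEnergy_eq_iff (hG : G.Connected) (hV : 1 < Fintype.card V) (hα : 1 / 2 < α) (u : V) :
    G.alphaEnergy α = 2 * (starRadius α (G.degree u) + 2 * α * (#G.edgeFinset - G.degree u) -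
      2 * α * #G.edgeFinset / Fintype.card V) ↔ G = starGraph u := by
  rw [eq_starGraph_iff_card_edgeFinset_eq_degree hG]
  refine ⟨fun h => ?_, fun h => (alphaEnergy_le hG hV hα.le u).antisymm ?_⟩
  · by_contra h_ne
    exact (alphaEnergy_lt hG hV hα ((G.degree_le_card_edgeFinset u).lt_of_ne' h_ne)).ne h
  · have h_star := ((eq_starGraph_iff_card_edgeFinset_eq_degree hG u).2 h).le
    have h_card : Fintype.card V ≤ 2 * #G.edgeFinset := by
      have := card_le_card_edgeFinset_add_one hG
      omega
    have h_lower := two_mul_starRadius_sub_le_alphaEnergy h_star (by linarith) h_card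
    rw [h] at h_lower ⊢
    rwa [sub_self, mul_zero, add_zero]

end Energy

end AlphaMatrix

open AlphaMatrix in
theorem theorem3p4_general {V : Type*} [Fintype V] [DecidableEq V] (G : SimpleGraph V)
    [DecidableRel G.Adj] (hG : G.Connected) (n m Δ : ℕ)
    (hn : n = Fintype.card V) (hm : m = G.edgeFinset.card) (hΔ : Δ = G.maxDegree)
    (hn2 : 2 ≤ n) (α : ℝ) (hα : 1 / 2 < α) :
    G.alphaEnergy α ≤
        α * (4 * (m : ℝ) - 3 * (Δ : ℝ) - 4 * (m : ℝ) / (n : ℝ) + 1)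
          + √(α ^ 2 * ((Δ : ℝ) + 1) ^ 2 + 4 * (1 - 2 * α) * (Δ : ℝ)) ∧
    (G.alphaEnergy α =
        α * (4 * (m : ℝ) - 3 * (Δ : ℝ) - 4 * (m : ℝ) / (n : ℝ) + 1)
          + √(α ^ 2 * ((Δ : ℝ) + 1) ^ 2 + 4 * (1 - 2 * α) * (Δ : ℝ)) ↔
      Nonempty (G ≃g completeBipartiteGraph (Fin 1) (Fin (n - 1)))) := by
  have h_bound : α * (4 * (m : ℝ) - 3 * Δ - 4 * m / n + 1) +
      √(α ^ 2 * ((Δ : ℝ) + 1) ^ 2 + 4 * (1 - 2 * α) * Δ) =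
        2 * (starRadius α Δ + 2 * α * (m - Δ) - 2 * α * m / n) := by
    rw [starRadius]
    ring
  subst hn hm
  have := hG.nonempty
  obtain ⟨u, hu⟩ := G.exists_maximal_degree_vertex
  rw [h_bound, nonempty_iso_completeBipartiteGraph_one_iff, exists_eq_starGraph_iff hG hu, hΔ, hu]
  exact ⟨alphaEnergy_le hG hn2 hα.le u, alphaEnergy_eq_iff hG hn2 hα u⟩

theorem theorem3p4 {V : Type*} [Fintype V] [DecidableEq V] (G : SimpleGraph V)
    [DecidableRel G.Adj] (hG : G.Connected) (n m Δ : ℕ)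
    (hn : n = Fintype.card V) (hm : m = G.edgeFinset.card) (hΔ : Δ = G.maxDegree)
    (hn2 : 2 ≤ n) (α : ℝ) (hα : 1 / 2 < α) (hα1 : α < 1) :
    G.alphaEnergy α ≤
        α * (4 * (m : ℝ) - 3 * (Δ : ℝ) - 4 * (m : ℝ) / (n : ℝ) + 1)
          + √(α ^ 2 * ((Δ : ℝ) + 1) ^ 2 + 4 * (1 - 2 * α) * (Δ : ℝ)) ∧
    (G.alphaEnergy α =
        α * (4 * (m : ℝ) - 3 * (Δ : ℝ) - 4 * (m : ℝ) / (n : ℝ) + 1)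
          + √(α ^ 2 * ((Δ : ℝ) + 1) ^ 2 + 4 * (1 - 2 * α) * (Δ : ℝ)) ↔
      Nonempty (G ≃g completeBipartiteGraph (Fin 1) (Fin (n - 1)))) :=
  theorem3p4_general G hG n m Δ hn hm hΔ hn2 α hα
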